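/- The Cayley--Dickson algebras are $A_0=\mathbb{R}$ and $A_n=A_{n-1}\times A_{n-1}$ with conjugation $(a,b)^*=(a^*,-b)$ (trivial on $A_0$) and product $(a,b)(c,d)=(ac-d^*b,\ da+bc^*)$; so $A_3$ is the algebra of octonions and $A_4$ that of sedenions. Put $\mathrm{Re}(x)=\frac12(x+x^*)$, $\mathrm{Im}(x)=x-\mathrm{Re}(x)$, $\langle x,y\rangle=\mathrm{Re}(xy^*)$, $\|x\|=\sqrt{\langle x,x\rangle}$, $x\times y=\mathrm{Im}(xy^*)$, and call $x$ imaginary if $\mathrm{Re}(x)=0$. Let $\langle\langle a,b\rangle\rangle$ be the smallest real subspace containing $1,a,b$ that is closed under multiplication and conjugation. For $u\neq0$ in $A_n$, let $M_u(x)=\|u\|^{-2}\,u^*(ux)$; the eigenvalues and eigenspaces $\mathrm{Eig}_\lambda(u)$ of $u$ are those of the $\mathbb{R}$-linear map $M_u$. Let $\mathbb{C}_4\subset A_4$ be the real span of $1$ and $i_4=(0,1)$. **Theorem.** Let $a,b$ be linearly independent imaginary elements of $A_3$ with $\|a\|^2+\|b\|^2=1$. Then $(a,b)$ is a unit vector of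 $A_4$ and $a\times b\ne0$. Set $c=a\times b/\|a\times b\|$. Then 1. $\mathrm{Eig}_1(a,b)=\langle\langle a,b\rangle\rangle\times\langle\langle a,b\rangle\rangle$; 2. $\mathrm{Eig}_{1+2\|a\times b\|}(a,b)=\{(x,-cx): x\in\langle\langle a,b\rangle\rangle^\perp\}$; 3. $\mathrm{Eig}_{1-2\|a\times b\|}(a,b)=\{(x,cx): x\in\langle\langle a,b\rangle\rangle^\perp\}$; 4. $A_4$ is the direct sum of these three subspaces, and the eigenvalues of $(a,b)$ are exactly $1$, $1+2\|a\times b\|$ and $1-2\|a\times b\|$. Moreover, this gives the full eigentheory of the elements of $A_4$ orthogonal to $\mathbb{C}_4$: every non-zero $u\in\mathbb{C}_4^\perp$ can be written as $u=t\,(a,b)$ with $t>0$ real and $a,b\in A_3$ imaginary such that $\|a\|^2+\|b\|^2=1$ and $M_u=M_{(a,b)}$, and if $a,b$ are linearly dependent, then $M_u$ is the identity. -/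

import Mathlib

/-- The underlying space of the Cayley-Dickson algebra `A_n`: `A_0 = ℝ` and
`A_{n+1} = A_n × A_n`. -/
def CD : ℕ → Type
  | 0 => ℝ
  | n + 1 => CD n × CD n

namespace CD

/-- The element `(a, b)` of `A_{n+1}`. -/
def pair {n : ℕ} (a b : CD n) : CD (n + 1) := ((a, b) : CD n × CD n)

/-- First component of an element of `A_{n+1}`. -/
def fst {n : ℕ} (x : CD (n + 1)) : CD n := Prod.fst (α := CD n) (β := CD n) x

/-- Second component of an element of `A_{n+1}`. -/
def snd {n : ℕ} (x : CD (n + 1)) : CD n := Prod.snd (α := CD n) (β := CD n) x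

@[simp] theorem fst_pair {n : ℕ} (a b : CD n) : (pair a b).fst = a := rfl
@[simp] theorem snd_pair {n : ℕ} (a b : CD n) : (pair a b).snd = b := rfl
@[simp] theorem pair_eta {n : ℕ} (x : CD (n + 1)) : pair x.fst x.snd = x := rfl

theorem ext {n : ℕ} {x y : CD (n + 1)} (h₁ : x.fst = y.fst) (h₂ : x.snd = y.snd) : x = y :=
  Prod.ext h₁ h₂

/-! Additive and linear structure (componentwise). -/

noncomputable instance instAddCommGroup : (n : ℕ) → AddCommGroup (CD n)
  | 0 => inferInstanceAs (AddCommGroup ℝ)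
  | n + 1 =>
    letI := instAddCommGroup n
    inferInstanceAs (AddCommGroup (CD n × CD n))

noncomputable instance instModule : (n : ℕ) → Module ℝ (CD n)
  | 0 => inferInstanceAs (Module ℝ ℝ)
  | n + 1 =>
    letI := instModule n
    inferInstanceAs (Module ℝ (CD n × CD n))

@[simp] theorem fst_zero {n : ℕ} : (0 : CD (n + 1)).fst = 0 := rfl
@[simp] theorem snd_zero {n : ℕ} : (0 : CD (n + 1)).snd = 0 := rfl
@[simp] theorem fst_add {n : ℕ} (x y : CD (n + 1)) : (x + y).fst = x.fst + y.fst := rfl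
@[simp] theorem snd_add {n : ℕ} (x y : CD (n + 1)) : (x + y).snd = x.snd + y.snd := rfl
@[simp] theorem fst_smul {n : ℕ} (r : ℝ) (x : CD (n + 1)) : (r • x).fst = r • x.fst := rfl
@[simp] theorem snd_smul {n : ℕ} (r : ℝ) (x : CD (n + 1)) : (r • x).snd = r • x.snd := rfl

/-- Conjugation: trivial on `A_0 = ℝ`, and `(a, b)^* = (a^*, -b)`. -/
noncomputable def conj : (n : ℕ) → CD n → CD n
  | 0, x => x
  | n + 1, x => pair (conj n (fst x)) (-(snd x))

/-- Multiplication: that of `ℝ` on `A_0`, and `(a, b)(c, d) = (ac - d^* b, da + b c^*)`. -/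
noncomputable def mul : (n : ℕ) → CD n → CD n → CD n
  | 0, x, y => Mul.mul (α := ℝ) x y
  | n + 1, x, y =>
    pair (mul n (fst x) (fst y) - mul n (conj n (snd y)) (snd x))
      (mul n (snd y) (fst x) + mul n (snd x) (conj n (fst y)))

/-- The unit `1 = (1, 0)`. -/
noncomputable def one : (n : ℕ) → CD n
  | 0 => (1 : ℝ)
  | n + 1 => pair (one n) 0

theorem conj_add' : (n : ℕ) → (x y : CD n) → conj n (x + y) = conj n x + conj n y
  | 0, _, _ => rfl
  | n + 1, x, y => ext (conj_add' n x.fst y.fst) (neg_add (snd x) (snd y))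

theorem conj_smul' : (n : ℕ) → (r : ℝ) → (x : CD n) → conj n (r • x) = r • conj n x
  | 0, _, _ => rfl
  | n + 1, r, x => ext (conj_smul' n r x.fst) (smul_neg r (snd x)).symm

theorem conj_zero' (n : ℕ) : conj n 0 = 0 := by
  simpa using conj_smul' n 0 0

theorem conj_neg' (n : ℕ) (x : CD n) : conj n (-x) = -conj n x := by
  simpa using conj_smul' n (-1) x

theorem conj_sub' (n : ℕ) (x y : CD n) : conj n (x - y) = conj n x - conj n y := by
  rw [sub_eq_add_neg, conj_add', conj_neg', sub_eq_add_neg]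

theorem conj_conj' : (n : ℕ) → (x : CD n) → conj n (conj n x) = x
  | 0, _ => rfl
  | n + 1, x => ext (conj_conj' n x.fst) (neg_neg (snd x))

theorem mul_add' : (n : ℕ) → (x y z : CD n) → mul n x (y + z) = mul n x y + mul n x z
  | 0, x, y, z => left_distrib (R := ℝ) x y z
  | n + 1, x, y, z => by
    have add_mul' : ∀ x y z : CD n, mul n (x + y) z = mul n x z + mul n y z := add_mul_aux n
    apply ext
    · simp only [mul, fst_pair, fst_add, snd_add, conj_add', mul_add' n, add_mul']
      abel
    · simp only [mul, snd_pair, fst_add, snd_add, conj_add', mul_add' n, add_mul']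
      abel
where
  add_mul_aux : (n : ℕ) → (x y z : CD n) → mul n (x + y) z = mul n x z + mul n y z
  | 0, x, y, z => right_distrib (R := ℝ) x y z
  | n + 1, x, y, z => by
    apply ext
    · simp only [mul, fst_pair, fst_add, snd_add, mul_add' n, add_mul_aux n]
      abel
    · simp only [mul, snd_pair, fst_add, snd_add, mul_add' n, add_mul_aux n]
      abel

theorem add_mul' (n : ℕ) (x y z : CD n) : mul n (x + y) z = mul n x z + mul n y z :=
  mul_add'.add_mul_aux n x y z

theorem mul_smul_smul' : (n : ℕ) → (r : ℝ) → (x y : CD n) →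
    mul n (r • x) y = r • mul n x y ∧ mul n x (r • y) = r • mul n x y
  | 0, r, x, y => ⟨mul_assoc (G := ℝ) r x y, mul_left_comm (G := ℝ) x r y⟩
  | n + 1, r, x, y => by
    have h₁ : ∀ x y : CD n, mul n (r • x) y = r • mul n x y :=
      fun x y => (mul_smul_smul' n r x y).1
    have h₂ : ∀ x y : CD n, mul n x (r • y) = r • mul n x y :=
      fun x y => (mul_smul_smul' n r x y).2
    constructor <;> apply ext <;>
      simp only [mul, fst_pair, snd_pair, fst_smul, snd_smul, conj_smul', h₁, h₂, smul_add,
        smul_sub]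

theorem mul_zero' (n : ℕ) (x : CD n) : mul n x 0 = 0 := by
  simpa using (mul_smul_smul' n 0 x 0).2

theorem zero_mul' (n : ℕ) (x : CD n) : mul n 0 x = 0 := by
  simpa using (mul_smul_smul' n 0 0 x).1

theorem conj_one' : (n : ℕ) → conj n (one n) = one n
  | 0 => rfl
  | n + 1 => ext (conj_one' n) (neg_zero (G := CD n))

theorem mul_one_one' : (n : ℕ) → (x : CD n) → mul n x (one n) = x ∧ mul n (one n) x = x
  | 0, x => ⟨mul_one (M := ℝ) x, one_mul (M := ℝ) x⟩
  | n + 1, x => by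
    have h₁ : ∀ x : CD n, mul n x (one n) = x := fun x => (mul_one_one' n x).1
    have h₂ : ∀ x : CD n, mul n (one n) x = x := fun x => (mul_one_one' n x).2
    constructor <;> apply ext <;>
      simp [mul, one, conj_zero', conj_one', mul_zero', zero_mul', h₁, h₂]

theorem neg_mul_mul_neg' (n : ℕ) (x y : CD n) :
    mul n (-x) y = -mul n x y ∧ mul n x (-y) = -mul n x y := by
  simpa using mul_smul_smul' n (-1) x y

theorem conj_mul' : (n : ℕ) → (x y : CD n) → conj n (mul n x y) = mul n (conj n y) (conj n x)
  | 0, x, y => mul_comm (G := ℝ) x y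
  | n + 1, x, y => by
    have h₁ : ∀ x y : CD n, mul n (-x) y = -mul n x y := fun x y => (neg_mul_mul_neg' n x y).1
    have h₂ : ∀ x y : CD n, mul n x (-y) = -mul n x y := fun x y => (neg_mul_mul_neg' n x y).2
    apply ext
    · simp [mul, conj, conj_sub', conj_mul' n, conj_conj', conj_neg', h₁, h₂]
    · simp [mul, conj, conj_conj', h₁, add_comm]

/-- `A_n` is a (unital, non-associative) ring. -/
noncomputable instance instNonAssocRing (n : ℕ) : NonAssocRing (CD n) :=
  { instAddCommGroup n with
    mul := mul n
    one := one n
    left_distrib := mul_add' n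
    right_distrib := add_mul' n
    zero_mul := zero_mul' n
    mul_zero := mul_zero' n
    one_mul := fun x => (mul_one_one' n x).2
    mul_one := fun x => (mul_one_one' n x).1 }

instance instIsScalarTower (n : ℕ) : IsScalarTower ℝ (CD n) (CD n) :=
  ⟨fun r x y => (mul_smul_smul' n r x y).1⟩

instance instSMulCommClass (n : ℕ) : SMulCommClass ℝ (CD n) (CD n) :=
  ⟨fun r x y => ((mul_smul_smul' n r x y).2).symm⟩

/-- `star x` is the conjugate `x^*`. -/
noncomputable instance instStarRing (n : ℕ) : StarRing (CD n) where
  star := conj n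
  star_involutive := conj_conj' n
  star_mul := conj_mul' n
  star_add := conj_add' n

@[simp] theorem fst_neg {n : ℕ} (x : CD (n + 1)) : (-x).fst = -x.fst := rfl
@[simp] theorem snd_neg {n : ℕ} (x : CD (n + 1)) : (-x).snd = -x.snd := rfl
@[simp] theorem fst_one {n : ℕ} : (1 : CD (n + 1)).fst = 1 := rfl
@[simp] theorem snd_one {n : ℕ} : (1 : CD (n + 1)).snd = 0 := rfl
@[simp] theorem fst_star {n : ℕ} (x : CD (n + 1)) : (star x).fst = star x.fst := rfl
@[simp] theorem snd_star {n : ℕ} (x : CD (n + 1)) : (star x).snd = -x.snd := rfl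
@[simp] theorem fst_mul {n : ℕ} (x y : CD (n + 1)) :
    (x * y).fst = x.fst * y.fst - star y.snd * x.snd := rfl
@[simp] theorem snd_mul {n : ℕ} (x y : CD (n + 1)) :
    (x * y).snd = y.snd * x.fst + x.snd * star y.fst := rfl

/-! Real and imaginary parts. -/

/-- `Re x = (x + x^*) / 2`, an element of `A_n`. -/
noncomputable def rePart {n : ℕ} (x : CD n) : CD n := (1 / 2 : ℝ) • (x + star x)

/-- `Im x = x - Re x`. -/
noncomputable def imPart {n : ℕ} (x : CD n) : CD n := x - rePart x

/-- `x` is imaginary if its real part vanishes. -/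
def IsImaginary {n : ℕ} (x : CD n) : Prop := rePart x = 0

/-- `Re x` as a real number, see `rePart_eq`. -/
noncomputable def reCoord : (n : ℕ) → CD n → ℝ
  | 0, x => x
  | n + 1, x => reCoord n (fst x)

/-- `Re x` is the real number `reCoord x`, seen in `A_n` as a multiple of `1`. -/
theorem rePart_eq : (n : ℕ) → (x : CD n) → rePart x = reCoord n x • (1 : CD n)
  | 0, x => by
    have h : ∀ r : ℝ, (1 / 2 : ℝ) * (r + r) = r * 1 := fun r => by ring
    exact h x
  | n + 1, x => by
    apply ext
    · exact rePart_eq n x.fst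
    · simp [rePart]

theorem reCoord_add : (n : ℕ) → (x y : CD n) → reCoord n (x + y) = reCoord n x + reCoord n y
  | 0, _, _ => rfl
  | n + 1, x, y => reCoord_add n x.fst y.fst

theorem reCoord_smul : (n : ℕ) → (r : ℝ) → (x : CD n) → reCoord n (r • x) = r * reCoord n x
  | 0, _, _ => rfl
  | n + 1, r, x => reCoord_smul n r x.fst

theorem reCoord_neg (n : ℕ) (x : CD n) : reCoord n (-x) = -reCoord n x := by
  simpa using reCoord_smul n (-1) x

theorem reCoord_star : (n : ℕ) → (x : CD n) → reCoord n (star x) = reCoord n x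
  | 0, _ => rfl
  | n + 1, x => reCoord_star n x.fst

theorem reCoord_mul_comm : (n : ℕ) → (x y : CD n) → reCoord n (x * y) = reCoord n (y * x)
  | 0, x, y => mul_comm (G := ℝ) x y
  | n + 1, x, y => by
    have h : reCoord n (star y.snd * x.snd) = reCoord n (star x.snd * y.snd) := by
      rw [← reCoord_star, star_mul, star_star]
    simp only [reCoord, fst_mul, sub_eq_add_neg, reCoord_add, reCoord_neg, h,
      reCoord_mul_comm n x.fst]

/-- The real inner product `Re (x y^*)` is the componentwise one. -/
theorem reCoord_mul_star (n : ℕ) (x y : CD (n + 1)) :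
    reCoord (n + 1) (x * star y) =
      reCoord n (x.fst * star y.fst) + reCoord n (x.snd * star y.snd) := by
  simp only [reCoord, fst_mul, fst_star, snd_star, star_neg, neg_mul, sub_neg_eq_add, reCoord_add]
  rw [reCoord_mul_comm n (star y.snd)]

theorem reCoord_self_nonneg : (n : ℕ) → (x : CD n) → 0 ≤ reCoord n (x * star x)
  | 0, x => mul_self_nonneg (R := ℝ) x
  | n + 1, x => by
    rw [reCoord_mul_star]
    exact add_nonneg (reCoord_self_nonneg n _) (reCoord_self_nonneg n _)

theorem reCoord_self_definite : (n : ℕ) → (x : CD n) → reCoord n (x * star x) = 0 → x = 0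
  | 0, x, h => (mul_self_eq_zero (M₀ := ℝ)).1 h
  | n + 1, x, h => by
    rw [reCoord_mul_star] at h
    have h₁ := reCoord_self_nonneg n x.fst
    have h₂ := reCoord_self_nonneg n x.snd
    exact ext (reCoord_self_definite n _ (by linarith)) (reCoord_self_definite n _ (by linarith))

/-- The real inner product `⟨x, y⟩ = Re (x y^*)`. -/
@[reducible]
noncomputable def innerCore (n : ℕ) : InnerProductSpace.Core ℝ (CD n) where
  inner x y := reCoord n (x * star y)
  conj_inner_symm x y := by
    change reCoord n (y * star x) = reCoord n (x * star y)
    rw [← reCoord_star, star_mul, star_star]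
  re_inner_nonneg x := reCoord_self_nonneg n x
  add_left x y z := by
    change reCoord n ((x + y) * star z) = _
    rw [add_mul, reCoord_add]
  smul_left x y r := by
    change reCoord n ((r • x) * star y) = r * reCoord n (x * star y)
    rw [smul_mul_assoc, reCoord_smul]
  definite x h := reCoord_self_definite n x h

/-- The norm `‖x‖ = √⟨x, x⟩`. -/
noncomputable instance instNormedAddCommGroup (n : ℕ) : NormedAddCommGroup (CD n) :=
  (innerCore n).toNormedAddCommGroup

noncomputable instance instInnerProductSpace (n : ℕ) : InnerProductSpace ℝ (CD n) :=
  InnerProductSpace.ofCore (innerCore n).toCore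

theorem inner_def {n : ℕ} (x y : CD n) : inner ℝ x y = reCoord n (x * star y) := rfl

/-! Notions built on the algebra structure. -/

/-- The cross-product `a × b = Im (a b^*)`. -/
noncomputable def cross {n : ℕ} (a b : CD n) : CD n := imPart (a * star b)

/-- The distinguished element `i_{n+1} = (0, 1)` of `A_{n+1}`. -/
noncomputable def iElt (n : ℕ) : CD (n + 1) := pair 0 1

/-- The subspace `ℂ_{n+1}` of `A_{n+1}`, the real span of `1` and `i_{n+1}`. -/
noncomputable def complexLine (n : ℕ) : Submodule ℝ (CD (n + 1)) := Submodule.span ℝ {1, iElt n}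

/-- A subalgebra is a linear subspace containing `1` and closed under multiplication and
conjugation. -/
structure IsSubalg {n : ℕ} (S : Submodule ℝ (CD n)) : Prop where
  one_mem : (1 : CD n) ∈ S
  mul_mem : ∀ x ∈ S, ∀ y ∈ S, x * y ∈ S
  star_mem : ∀ x ∈ S, star x ∈ S

/-- `⟨⟨s⟩⟩`: the smallest subalgebra containing the set `s`. -/
noncomputable def generated {n : ℕ} (s : Set (CD n)) : Submodule ℝ (CD n) :=
  sInf {S | IsSubalg S ∧ s ⊆ S}

theorem isSubalg_generated {n : ℕ} (s : Set (CD n)) : IsSubalg (generated s) := by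
  constructor
  · exact (Submodule.mem_sInf).2 fun S hS => hS.1.one_mem
  · intro x hx y hy
    exact (Submodule.mem_sInf).2 fun S hS =>
      hS.1.mul_mem x ((Submodule.mem_sInf).1 hx S hS) y ((Submodule.mem_sInf).1 hy S hS)
  · intro x hx
    exact (Submodule.mem_sInf).2 fun S hS => hS.1.star_mem x ((Submodule.mem_sInf).1 hx S hS)

/-- The operator `M_a = ‖a‖⁻² L_{a^*} L_a` (for `a ≠ 0`). -/
noncomputable def M {n : ℕ} (a : CD n) : Module.End ℝ (CD n) :=
  (1 / ‖a‖ ^ 2) • (LinearMap.mulLeft ℝ (star a) ∘ₗ LinearMap.mulLeft ℝ a)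

/-- `Eig_r(a)`, the `r`-eigenspace of `M_a`. -/
noncomputable def Eig {n : ℕ} (r : ℝ) (a : CD n) : Submodule ℝ (CD n) :=
  Module.End.eigenspace (M a) r

end CD

namespace CD

/-! Everything reduces to one operator on the octonions, `D x = (a x) b - a (x b)`, the associator
`[a, x, b]`. For imaginary `a`, `b` with `‖a‖² + ‖b‖² = 1`, alternativity of `A_3` gives `M (x, y) =
(x + D y, y - D x)` (`M_pair`), so `(x, y)` has eigenvalue `1 + s` exactly when `D y = s x` and `D x
= -s y`.

Let `S = ⟨⟨a, b⟩⟩`. It is spanned by `1, a, b, ab`, and `D` vanishes on it. On `Sᗮ`, `D` is left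
multiplication by `2 (a × b)` (`associatorMap_of_orthogonal`). This preserves `Sᗮ` and squares to
`-(2‖a × b‖)²`, because `a × b` is imaginary and lies in `S`. If `a × b ≠ 0`, then `ker D = S`,
which settles `s = 0`; for `s ≠ 0`, `x` lies in `Sᗮ`, `y = -s⁻¹ D x`, and nonzero solutions require
`s = ±2‖a × b‖`. Linearly dependent `a`, `b` give `D = 0`. -/

/-! ### Real parts, conjugates and norms. -/

theorem self_add_star {n : ℕ} (x : CD n) : x + star x = (2 * reCoord n x) • (1 : CD n) := by
  rw [mul_smul, ← rePart_eq, rePart, smul_smul]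
  norm_num

theorem star_eq {n : ℕ} (x : CD n) : star x = (2 * reCoord n x) • (1 : CD n) - x := by
  rw [← self_add_star, add_sub_cancel_left]

theorem reCoord_one : (n : ℕ) → reCoord n (1 : CD n) = 1
  | 0 => rfl
  | n + 1 => reCoord_one n

theorem star_smul' {n : ℕ} (r : ℝ) (x : CD n) : star (r • x) = r • star x :=
  conj_smul' n r x

theorem isImaginary_iff {n : ℕ} {x : CD n} : x.IsImaginary ↔ reCoord n x = 0 := by
  rw [IsImaginary, rePart_eq]
  constructor
  · intro h
    have h₁ := congrArg (reCoord n) h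
    rwa [← zero_smul ℝ (1 : CD n), reCoord_smul, reCoord_smul, reCoord_one, mul_one,
      zero_mul] at h₁
  · intro h
    rw [h]
    exact zero_smul ℝ (1 : CD n)

theorem IsImaginary.star_eq {n : ℕ} {x : CD n} (h : x.IsImaginary) : star x = -x := by
  rw [CD.star_eq, isImaginary_iff.1 h]
  simp

/-- The product is self-conjugate, hence equal to its real part. -/
theorem mul_star_self {n : ℕ} (x : CD n) : x * star x = (‖x‖ ^ 2) • (1 : CD n) := by
  have h := self_add_star (x * star x)
  rw [star_mul, star_star, ← two_smul ℝ, mul_smul, ← inner_def, real_inner_self_eq_norm_sq] at h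
  exact smul_right_injective _ (two_ne_zero' ℝ) h

theorem star_mul_self {n : ℕ} (x : CD n) : star x * x = (‖x‖ ^ 2) • (1 : CD n) := by
  rw [← mul_star_self, CD.star_eq]
  simp [mul_sub, sub_mul]

theorem norm_sq_eq {n : ℕ} (x : CD (n + 1)) : ‖x‖ ^ 2 = ‖x.fst‖ ^ 2 + ‖x.snd‖ ^ 2 := by
  simp only [← real_inner_self_eq_norm_sq, inner_def]
  exact reCoord_mul_star n x x

/-! ### Associativity of `A_2` and alternativity of `A_3`. -/

theorem mul_comm_zero (x y : CD 0) : x * y = y * x := mul_comm (G := ℝ) x y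

theorem mul_comm_one (x y : CD 1) : x * y = y * x := by
  have hs : ∀ x : CD 0, star x = x := fun _ => rfl
  apply ext
  · simp only [fst_mul, hs, mul_comm_zero x.fst, mul_comm_zero x.snd]
  · simp only [snd_mul, hs]
    rw [add_comm]

theorem mul_assoc_succ {n : ℕ} (hc : ∀ x y : CD n, x * y = y * x)
    (ha : ∀ x y z : CD n, x * y * z = x * (y * z)) (x y z : CD (n + 1)) :
    x * y * z = x * (y * z) := by
  -- With left commutativity, `simp` can sort every product into a normal form.
  have hl : ∀ x y z : CD n, x * (y * z) = y * (x * z) := fun x y z => by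
    rw [← ha, hc x, ha]
  apply ext
  · simp only [fst_mul, snd_mul, mul_sub, add_mul, mul_add, star_add, star_mul, star_star,
      ha, hc, hl]
    abel
  · simp only [fst_mul, snd_mul, mul_sub, add_mul, mul_add, star_sub, star_mul, star_star,
      ha, hc, hl]
    abel

theorem mul_assoc_two (x y z : CD 2) : x * y * z = x * (y * z) :=
  mul_assoc_succ mul_comm_one (mul_assoc_succ mul_comm_zero fun x y z => mul_assoc (G := ℝ) x y z)
    x y z

/-- The double of an associative algebra is left alternative: the mixed terms cancel by
associativity and the others collect into norms. -/
theorem star_mul_self_mul_succ {n : ℕ} (ha : ∀ x y z : CD n, x * y * z = x * (y * z))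
    (x y : CD (n + 1)) : star x * (x * y) = (‖x‖ ^ 2) • y := by
  have h₁ : ∀ p r : CD n, star p * (p * r) = ‖p‖ ^ 2 • r := fun p r => by
    rw [← ha, star_mul_self, smul_one_mul]
  have h₂ : ∀ p r : CD n, p * (star p * r) = ‖p‖ ^ 2 • r := fun p r => by
    rw [← ha, mul_star_self, smul_one_mul]
  rw [norm_sq_eq]
  apply ext
  · simp only [fst_mul, snd_mul, fst_star, snd_star, mul_sub, star_add, star_mul, star_star, ha,
      mul_neg, add_mul, h₁, star_mul_self, mul_smul_comm, mul_one, fst_smul, fst_add, add_smul]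
    abel
  · simp only [fst_mul, snd_mul, fst_star, snd_star, mul_sub, star_sub, star_mul, star_star, ha,
      neg_mul, add_mul, h₂, mul_star_self, mul_smul_comm, mul_one, snd_smul, snd_add, add_smul]
    abel

theorem star_mul_self_mul (x y : CD 3) : star x * (x * y) = (‖x‖ ^ 2) • y :=
  star_mul_self_mul_succ mul_assoc_two x y

/-- Substituting `x^* = 2 Re x - x` in `star_mul_self_mul` leaves the left alternative law. -/
theorem mul_self_mul (x y : CD 3) : x * x * y = x * (x * y) := by
  have h₁ := star_mul_self_mul x y
  have h₂ := star_mul_self x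
  rw [star_eq, sub_mul, smul_one_mul] at h₁ h₂
  rw [← sub_sub_cancel ((2 * reCoord 3 x) • x) (x * x), h₂, sub_mul, smul_mul_assoc,
    smul_one_mul, ← h₁, sub_sub_cancel]

theorem mul_mul_self (x y : CD 3) : y * x * x = y * (x * x) := by
  have h := congrArg star (mul_self_mul (star x) (star y))
  simpa using h.symm

/-! ### The alternating octonion associator. -/

theorem associator_self_left (x y : CD 3) : associator x x y = 0 := by
  rw [associator, mul_self_mul, sub_self]

theorem associator_self_right (x y : CD 3) : associator y x x = 0 := by
  rw [associator, mul_mul_self, sub_self]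

theorem associator_swap_left (x y z : CD 3) : associator x y z = -associator y x z := by
  have h := mul_self_mul (x + y) z
  simp only [add_mul, mul_add, mul_self_mul] at h
  rw [← sub_eq_zero] at h ⊢
  rw [← h, associator, associator]
  abel

theorem associator_swap_right (x y z : CD 3) : associator x y z = -associator x z y := by
  have h := mul_mul_self (y + z) x
  simp only [add_mul, mul_add, mul_mul_self] at h
  rw [← sub_eq_zero] at h ⊢
  rw [← h, associator, associator]
  abel

theorem associator_flexible (x y : CD 3) : associator x y x = 0 := by
  rw [associator_swap_right, associator_self_left, neg_zero]

theorem associator_star_left (x y z : CD 3) : associator (star x) y z = -associator x y z := by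
  rw [star_eq, associator, associator, sub_mul, sub_mul, sub_mul, smul_one_mul, smul_one_mul,
    smul_mul_assoc]
  abel

theorem associator_star_mid (x y z : CD 3) : associator x (star y) z = -associator x y z := by
  rw [associator_swap_left, associator_star_left, associator_swap_left x y z]

theorem associator_star_right (x y z : CD 3) : associator x y (star z) = -associator x y z := by
  rw [associator_swap_right, associator_star_mid, associator_swap_right x y z]

theorem associator_reverse (x y z : CD 3) : associator x y z = -associator z y x := by
  rw [associator_swap_left, associator_swap_right, associator_swap_left, neg_neg]

/-- Conjugation reverses the entries and changes the sign; removing the three stars costs three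
signs, and restoring the order one more. So associators are imaginary. -/
theorem star_associator (x y z : CD 3) : star (associator x y z) = -associator x y z := by
  have h : star (associator x y z) = -associator (star z) (star y) (star x) := by
    simp [associator]
  rw [h, associator_star_left, associator_star_mid, associator_star_right, neg_neg, neg_neg,
    associator_reverse]

theorem reCoord_sub {n : ℕ} (x y : CD n) : reCoord n (x - y) = reCoord n x - reCoord n y := by
  rw [sub_eq_add_neg, reCoord_add, reCoord_neg, sub_eq_add_neg]

theorem reCoord_mul_assoc (x y z : CD 3) :
    reCoord 3 (x * y * z) = reCoord 3 (x * (y * z)) := by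
  have h : reCoord 3 (associator x y z) = 0 := by
    have h₁ := reCoord_star 3 (associator x y z)
    rw [star_associator, reCoord_neg] at h₁
    linarith
  rw [associator, reCoord_sub] at h
  linarith

/-- Real parts of triple products do not depend on bracketing and are cyclic. -/
theorem inner_mul_left' (a x y : CD 3) : inner ℝ (a * x) y = inner ℝ x (star a * y) := by
  simp only [inner_def, star_mul, star_star]
  rw [reCoord_mul_assoc, reCoord_mul_comm, reCoord_mul_assoc]

/-! ### Imaginary elements. -/

theorem isImaginary_iff_inner {n : ℕ} {x : CD n} :
    x.IsImaginary ↔ inner ℝ (1 : CD n) x = (0 : ℝ) := by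
  rw [isImaginary_iff, inner_def, one_mul, reCoord_star]

theorem IsImaginary.anticomm {n : ℕ} {x y : CD n} (hx : x.IsImaginary) (hy : y.IsImaginary)
    (h : inner ℝ x y = (0 : ℝ)) : x * y = -(y * x) := by
  have h₁ := self_add_star (x * star y)
  rw [← inner_def, h, star_mul, star_star, hx.star_eq, hy.star_eq, mul_zero, zero_smul, mul_neg,
    mul_neg, ← neg_add, neg_eq_zero] at h₁
  exact eq_neg_of_add_eq_zero_left h₁

theorem IsImaginary.mul_self {n : ℕ} {x : CD n} (hx : x.IsImaginary) :
    x * x = -(‖x‖ ^ 2 • (1 : CD n)) := by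
  rw [← mul_star_self, hx.star_eq, mul_neg, neg_neg]

theorem IsImaginary.mul_mul_self_left {x : CD 3} (hx : x.IsImaginary) (y : CD 3) :
    x * (x * y) = -(‖x‖ ^ 2 • y) := by
  rw [← mul_self_mul, hx.mul_self, neg_mul, smul_one_mul]

theorem IsImaginary.mul_mul_self_right {x : CD 3} (hx : x.IsImaginary) (y : CD 3) :
    y * x * x = -(‖x‖ ^ 2 • y) := by
  rw [mul_mul_self, hx.mul_self, mul_neg, mul_smul_comm, mul_one]

theorem IsImaginary.mul_add_mul {n : ℕ} {x y : CD n} (hx : x.IsImaginary) (hy : y.IsImaginary) :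
    x * y + y * x = (-2 * inner ℝ x y : ℝ) • (1 : CD n) := by
  have h := self_add_star (x * star y)
  rw [← inner_def, star_mul, star_star, hx.star_eq, hy.star_eq, mul_neg, mul_neg, ← neg_add] at h
  rw [← neg_neg (x * y + y * x), h, ← neg_smul, neg_mul]

/-! ### The cross product and the associator map. -/

theorem isImaginary_cross {n : ℕ} (a b : CD n) : (cross a b).IsImaginary := by
  rw [isImaginary_iff, cross, imPart, rePart_eq, reCoord_sub, reCoord_smul, reCoord_one, mul_one,
    sub_self]

theorem two_smul_cross {n : ℕ} {a b : CD n} (ha : a.IsImaginary) (hb : b.IsImaginary) :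
    (2 : ℝ) • cross a b = b * a - a * b := by
  rw [cross, imPart, rePart, smul_sub, smul_smul, star_mul, star_star, ha.star_eq, hb.star_eq,
    mul_one_div_cancel two_ne_zero, one_smul, two_smul]
  simp only [mul_neg]
  abel

/-- If `a × b = 0` then `ab` is real, so `(ab)b = -‖b‖² a` is a real multiple of `b`; independence
then forces `b = 0`. -/
theorem cross_ne_zero {a b : CD 3} (ha : a.IsImaginary) (hb : b.IsImaginary)
    (hab : LinearIndependent ℝ ![a, b]) : cross a b ≠ 0 := by
  intro h
  have h₁ : a * b = (-inner ℝ a b : ℝ) • (1 : CD 3) := by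
    have h₂ := two_smul_cross ha hb
    have h₃ := ha.mul_add_mul hb
    rw [h, smul_zero] at h₂
    rw [sub_eq_zero.1 h₂.symm, ← two_smul ℝ, neg_mul_comm, mul_smul] at h₃
    exact smul_right_injective _ (two_ne_zero' ℝ) h₃
  have h₂ := hb.mul_mul_self_right a
  rw [h₁, smul_one_mul] at h₂
  have h₃ := LinearIndependent.pair_iff.1 hab (‖b‖ ^ 2) (-inner ℝ a b : ℝ) (by
    rw [h₂, add_neg_cancel])
  exact hab.ne_zero 1 (norm_eq_zero.1 (pow_eq_zero_iff two_ne_zero |>.1 h₃.1))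

/-- The linear map `x ↦ (a x) b - a (x b)`. -/
noncomputable def associatorMap (a b : CD 3) : Module.End ℝ (CD 3) :=
  LinearMap.mulRight ℝ b ∘ₗ LinearMap.mulLeft ℝ a - LinearMap.mulLeft ℝ a ∘ₗ LinearMap.mulRight ℝ b

theorem associatorMap_apply (a b x : CD 3) : associatorMap a b x = associator a x b := rfl

theorem isImaginary_mul {n : ℕ} {x y : CD n} (hy : y.IsImaginary) (h : inner ℝ x y = (0 : ℝ)) :
    (x * y).IsImaginary := by
  rw [inner_def, hy.star_eq, mul_neg, reCoord_neg, neg_eq_zero] at h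
  exact isImaginary_iff.2 h

/-- Both `x` and `bx` anticommute with `a`, which turns `[b, x, a] = -[b, a, x]` into the claim. -/
theorem mul_mul_of_orthogonal {a b x : CD 3} (ha : a.IsImaginary) (hb : b.IsImaginary)
    (hx : x.IsImaginary) (hax : inner ℝ a x = (0 : ℝ)) (hbx : inner ℝ b x = (0 : ℝ))
    (habx : inner ℝ (a * b) x = (0 : ℝ)) : a * (b * x) = b * a * x := by
  have h₁ : b * x * a = -(a * (b * x)) := by
    refine (isImaginary_mul hx hbx).anticomm ha ?_
    -- `⟨bx, a⟩ = -⟨x, ba⟩`, and `ba` is a real number minus `ab`.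
    rw [inner_mul_left', hb.star_eq, neg_mul, inner_neg_right, neg_eq_zero, real_inner_comm,
      eq_sub_of_add_eq (hb.mul_add_mul ha), inner_sub_left, habx, inner_smul_left,
      isImaginary_iff_inner.1 hx]
    simp
  have h₂ := associator_swap_right b x a
  rw [associator, associator, h₁, hx.anticomm ha (by rwa [real_inner_comm])] at h₂
  rw [mul_neg] at h₂
  rw [← sub_eq_zero] at h₂ ⊢
  rw [← neg_eq_zero, ← h₂]
  abel

theorem associatorMap_of_orthogonal {a b x : CD 3} (ha : a.IsImaginary) (hb : b.IsImaginary)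
    (hx : x.IsImaginary) (hax : inner ℝ a x = (0 : ℝ)) (hbx : inner ℝ b x = (0 : ℝ))
    (habx : inner ℝ (a * b) x = (0 : ℝ)) :
    associatorMap a b x = (2 : ℝ) • (cross a b * x) := by
  rw [associatorMap_apply, associator_swap_right, associator,
    mul_mul_of_orthogonal ha hb hx hax hbx habx, ← smul_mul_assoc, two_smul_cross ha hb, sub_mul,
    neg_sub]

/-! The subalgebra generated by two imaginary octonions. -/

theorem isSubalg_span {a b : CD 3} (ha : a.IsImaginary) (hb : b.IsImaginary) :
    IsSubalg (Submodule.span ℝ (Set.range ![1, a, b, a * b])) := by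
  set S := Submodule.span ℝ (Set.range ![1, a, b, a * b]) with hS
  have h1 : 1 ∈ S := Submodule.subset_span ⟨0, rfl⟩
  have hma : a ∈ S := Submodule.subset_span ⟨1, rfl⟩
  have hmb : b ∈ S := Submodule.subset_span ⟨2, rfl⟩
  have hmab : a * b ∈ S := Submodule.subset_span ⟨3, rfl⟩
  have hba : b * a = (-2 * inner ℝ b a : ℝ) • (1 : CD 3) - a * b :=
    eq_sub_of_add_eq (hb.mul_add_mul ha)
  have hstar : ∀ x ∈ S, star x ∈ S := fun x hx => by
    rw [star_eq]
    exact S.sub_mem (S.smul_mem _ h1) hx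
  have hmba : b * a ∈ S := hba ▸ S.sub_mem (S.smul_mem _ h1) hmab
  refine ⟨h1, fun x hx y hy => ?_, hstar⟩
  have key : ∀ i j, ![1, a, b, a * b] i * ![1, a, b, a * b] j ∈ S := by
    have haa : a * a ∈ S := ha.mul_self ▸ S.neg_mem (S.smul_mem _ h1)
    have hbb : b * b ∈ S := hb.mul_self ▸ S.neg_mem (S.smul_mem _ h1)
    have haab : a * (a * b) ∈ S := ha.mul_mul_self_left b ▸ S.neg_mem (S.smul_mem _ hmb)
    have habb : a * b * b ∈ S := hb.mul_mul_self_right a ▸ S.neg_mem (S.smul_mem _ hma)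
    -- Writing `ab` as a real number minus `ba` brings equal factors together.
    have hbab : b * (a * b) ∈ S := by
      rw [← sub_sub_cancel ((-2 * inner ℝ b a : ℝ) • (1 : CD 3)) (a * b), ← hba, mul_sub,
        hb.mul_mul_self_left, mul_smul_comm, mul_one]
      exact S.sub_mem (S.smul_mem _ hmb) (S.neg_mem (S.smul_mem _ hma))
    have haba : a * b * a ∈ S := by
      rw [← sub_sub_cancel ((-2 * inner ℝ b a : ℝ) • (1 : CD 3)) (a * b), ← hba, sub_mul,
        ha.mul_mul_self_right, smul_one_mul]
      exact S.sub_mem (S.smul_mem _ hma) (S.neg_mem (S.smul_mem _ hmb))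
    have habab : a * b * (a * b) ∈ S := by
      have h := star_mul_self (a * b)
      rw [star_eq, sub_mul, smul_one_mul] at h
      rw [← sub_sub_cancel ((2 * reCoord 3 (a * b)) • (a * b)) (a * b * (a * b)), h]
      exact S.sub_mem (S.smul_mem _ hmab) (S.smul_mem _ h1)
    intro i j
    fin_cases i <;> fin_cases j <;>
      simp [h1, hma, hmb, hmab, haa, hbb, hmba, haab, habb, hbab, haba, habab]
  induction hx using Submodule.span_induction with
  | mem x hx =>
    obtain ⟨i, rfl⟩ := hx
    induction hy using Submodule.span_induction with
    | mem y hy =>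
      obtain ⟨j, rfl⟩ := hy
      exact key i j
    | zero => rw [mul_zero]; exact S.zero_mem
    | add y z _ _ h h' => rw [mul_add]; exact S.add_mem h h'
    | smul r y _ h => rw [mul_smul_comm]; exact S.smul_mem r h
  | zero => rw [zero_mul]; exact S.zero_mem
  | add y z _ _ h h' => rw [add_mul]; exact S.add_mem h h'
  | smul r y _ h => rw [smul_mul_assoc]; exact S.smul_mem r h

theorem subset_generated {n : ℕ} (s : Set (CD n)) : s ⊆ generated s := fun _ hx =>
  Submodule.mem_sInf.2 fun _ hS => hS.2 hx

theorem generated_le_span {a b : CD 3} (ha : a.IsImaginary) (hb : b.IsImaginary) :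
    generated {a, b} ≤ Submodule.span ℝ (Set.range ![1, a, b, a * b]) := by
  refine sInf_le ⟨isSubalg_span ha hb, ?_⟩
  rintro x (rfl | rfl)
  · exact Submodule.subset_span ⟨1, rfl⟩
  · exact Submodule.subset_span ⟨2, rfl⟩

/-- It suffices to check the four spanning elements; for `ab` both bracketings give `‖a‖²‖b‖²`. -/
theorem associatorMap_of_mem_generated {a b x : CD 3} (ha : a.IsImaginary) (hb : b.IsImaginary)
    (hx : x ∈ generated {a, b}) : associatorMap a b x = 0 := by
  suffices h : Submodule.span ℝ (Set.range ![1, a, b, a * b]) ≤ LinearMap.ker (associatorMap a b) by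
    exact h (generated_le_span ha hb hx)
  rw [Submodule.span_le]
  rintro _ ⟨i, rfl⟩
  change associatorMap a b _ = 0
  rw [associatorMap_apply]
  fin_cases i
  · simp [associator]
  · exact associator_self_left a b
  · exact associator_self_right b a
  · change a * (a * b) * b - a * (a * b * b) = 0
    rw [ha.mul_mul_self_left, hb.mul_mul_self_right, neg_mul, mul_neg, smul_mul_assoc,
      mul_smul_comm, ha.mul_self, hb.mul_self, smul_neg, smul_neg, smul_comm, sub_self]

/-! ### The operator of a pair of imaginary octonions. -/

theorem M_apply {n : ℕ} (u x : CD n) : M u x = (1 / ‖u‖ ^ 2) • (star u * (u * x)) := rfl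

theorem M_smul {n : ℕ} {t : ℝ} (ht : t ≠ 0) (u : CD n) : M (t • u) = M u := by
  refine LinearMap.ext fun x => ?_
  rw [M_apply, M_apply, star_smul', smul_mul_assoc, smul_mul_assoc, mul_smul_comm, smul_smul,
    smul_smul, norm_smul, mul_pow, Real.norm_eq_abs, sq_abs]
  congr 1
  field_simp

theorem norm_pair {n : ℕ} {a b : CD n} (h : ‖a‖ ^ 2 + ‖b‖ ^ 2 = 1) : ‖pair a b‖ = 1 := by
  rw [← sq_eq_sq₀ (norm_nonneg _) zero_le_one, norm_sq_eq, fst_pair, snd_pair, h, one_pow]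

/-- Since `(a, b)^* = -(a, b)`, the operator is `-L²`, with `L` left multiplication by `(a, b)`. The
squares of `a` and `b` contribute the identity and the mixed terms are associators, whose conjugated
middle entry costs a sign. -/
theorem M_pair {a b : CD 3} (ha : a.IsImaginary) (hb : b.IsImaginary)
    (h : ‖a‖ ^ 2 + ‖b‖ ^ 2 = 1) (z : CD 4) :
    M (pair a b) z =
      pair (z.fst + associatorMap a b z.snd) (z.snd - associatorMap a b z.fst) := by
  have h₁ : star (pair a b) = -pair a b :=
    ext (by simp [ha.star_eq]) (by simp)
  rw [M_apply, norm_pair h, h₁]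
  norm_num
  apply ext
  · have h₂ := associator_star_mid a z.snd b
    have h₃ : ‖a‖ ^ 2 • z.fst = z.fst - ‖b‖ ^ 2 • z.fst := by
      rw [eq_sub_iff_add_eq, ← add_smul, h, one_smul]
    simp only [associator, associatorMap_apply, fst_neg, fst_mul, snd_mul, fst_pair, snd_pair,
      star_add, star_mul, star_star, ha.star_eq, hb.star_eq, add_mul, mul_sub, mul_neg,
      ha.mul_mul_self_left, hb.mul_mul_self_right, neg_mul] at h₂ ⊢
    rw [← sub_eq_zero] at h₂ ⊢
    rw [h₃, ← neg_eq_zero, ← h₂]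
    abel
  · have h₂ := associator_star_mid b z.fst a
    have h₃ : ‖a‖ ^ 2 • z.snd = z.snd - ‖b‖ ^ 2 • z.snd := by
      rw [eq_sub_iff_add_eq, ← add_smul, h, one_smul]
    -- Here the associator is `[b, x, a] = -[a, x, b]`, whence the opposite signs of the two
    -- components.
    rw [← associator_reverse] at h₂
    simp only [associator, associatorMap_apply, snd_neg, fst_mul, snd_mul, fst_pair, snd_pair,
      star_sub, star_mul, star_star, ha.star_eq, hb.star_eq, add_mul, mul_sub, mul_neg,
      hb.mul_mul_self_left, ha.mul_mul_self_right, neg_mul] at h₂ ⊢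
    rw [← sub_eq_zero] at h₂ ⊢
    rw [h₃, ← neg_eq_zero, ← h₂]
    abel

theorem mem_Eig_pair {a b : CD 3} (ha : a.IsImaginary) (hb : b.IsImaginary)
    (h : ‖a‖ ^ 2 + ‖b‖ ^ 2 = 1) (s : ℝ) (z : CD 4) :
    z ∈ Eig (1 + s) (pair a b) ↔
      associatorMap a b z.snd = s • z.fst ∧ associatorMap a b z.fst = -(s • z.snd) := by
  rw [Eig, Module.End.mem_eigenspace_iff, M_pair ha hb h, add_smul, one_smul]
  constructor
  · intro h
    have h₁ := congrArg fst h
    have h₂ := congrArg snd h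
    rw [fst_pair, fst_add, fst_smul] at h₁
    rw [snd_pair, snd_add, snd_smul, sub_eq_add_neg] at h₂
    exact ⟨add_left_cancel h₁, neg_eq_iff_eq_neg.1 (add_left_cancel h₂)⟩
  · rintro ⟨h₁, h₂⟩
    apply ext
    · rw [fst_pair, fst_add, fst_smul, h₁]
    · rw [snd_pair, snd_add, snd_smul, h₂, sub_neg_eq_add]

/-- Dependence makes `[a, x, b]` zero, by flexibility if `a ≠ 0`. -/
theorem M_pair_eq_id {a b : CD 3} (ha : a.IsImaginary) (hb : b.IsImaginary)
    (h : ‖a‖ ^ 2 + ‖b‖ ^ 2 = 1) (hab : ¬ LinearIndependent ℝ ![a, b]) :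
    M (pair a b) = LinearMap.id := by
  have h₀ : ∀ x, associatorMap a b x = 0 := fun x => by
    rw [associatorMap_apply]
    by_cases ha₀ : a = 0
    · rw [ha₀]
      simp [associator]
    · rw [LinearIndependent.pair_iff' ha₀] at hab
      push Not at hab
      obtain ⟨r, rfl⟩ := hab
      have h := associator_flexible a x
      rw [associator] at h ⊢
      rw [mul_smul_comm, mul_smul_comm, mul_smul_comm, ← smul_sub, h, smul_zero]
  refine LinearMap.ext fun z => ?_
  rw [M_pair ha hb h, h₀, h₀, add_zero, sub_zero]
  rfl

/-- `CD (n + 1)` is linearly equivalent to `CD n × CD n`. -/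
noncomputable def prodEquiv (n : ℕ) : CD (n + 1) ≃ₗ[ℝ] CD n × CD n where
  toFun x := (x.fst, x.snd)
  invFun p := pair p.1 p.2
  map_add' _ _ := rfl
  map_smul' _ _ := rfl

instance instFiniteDimensional : (n : ℕ) → FiniteDimensional ℝ (CD n)
  | 0 => inferInstanceAs (FiniteDimensional ℝ ℝ)
  | n + 1 =>
    haveI := instFiniteDimensional n
    (prodEquiv n).symm.finiteDimensional

theorem finrank_eq : (n : ℕ) → Module.finrank ℝ (CD n) = 2 ^ n
  | 0 => Module.finrank_self ℝ
  | n + 1 => by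
    rw [(prodEquiv n).finrank_eq, Module.finrank_prod, finrank_eq n, pow_succ, mul_two]

/-! ### Eigenspaces and eigenvalues in the independent case. -/

section Generated

variable {a b : CD 3}

/-- The subalgebra has dimension at most 4 in an 8-dimensional space. This makes the eigenvalues
other than 1 occur. -/
theorem exists_ne_zero_mem_orthogonal_generated (ha : a.IsImaginary) (hb : b.IsImaginary) :
    ∃ x ∈ (generated {a, b})ᗮ, x ≠ 0 := by
  have h₁ := Submodule.finrank_mono (generated_le_span ha hb)
  have h₂ : Module.finrank ℝ (Submodule.span ℝ (Set.range ![1, a, b, a * b])) ≤ 4 :=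
    finrank_range_le_card _
  have h₃ := (generated {a, b}).finrank_add_finrank_orthogonal
  rw [finrank_eq] at h₃
  refine Submodule.exists_mem_ne_zero_of_ne_bot fun h => ?_
  rw [h, finrank_bot] at h₃
  omega

theorem cross_mem_generated (a b : CD 3) : cross a b ∈ generated {a, b} := by
  have h := isSubalg_generated {a, b}
  have ha : a ∈ generated {a, b} := subset_generated _ (Set.mem_insert _ _)
  have hb : b ∈ generated {a, b} := subset_generated _ (Set.mem_insert_of_mem _ rfl)
  have hab := h.mul_mem _ ha _ (h.star_mem _ hb)
  rw [cross, imPart, rePart_eq]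
  exact Submodule.sub_mem _ hab (Submodule.smul_mem _ _ h.one_mem)

/-- The adjoint of left multiplication by `c` is that by `c^*`, which preserves `S`. -/
theorem mul_mem_orthogonal {S : Submodule ℝ (CD 3)} (hS : IsSubalg S) {c x : CD 3} (hc : c ∈ S)
    (hx : x ∈ Sᗮ) : c * x ∈ Sᗮ := by
  intro y hy
  rw [real_inner_comm, inner_mul_left', real_inner_comm]
  exact hx _ (hS.mul_mem _ (hS.star_mem _ hc) _ hy)

theorem associatorMap_of_mem_orthogonal (ha : a.IsImaginary) (hb : b.IsImaginary) {x : CD 3}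
    (hx : x ∈ (generated {a, b})ᗮ) : associatorMap a b x = (2 : ℝ) • (cross a b * x) := by
  have h := isSubalg_generated {a, b}
  have hma : a ∈ generated {a, b} := subset_generated _ (Set.mem_insert _ _)
  have hmb : b ∈ generated {a, b} := subset_generated _ (Set.mem_insert_of_mem _ rfl)
  exact associatorMap_of_orthogonal ha hb (isImaginary_iff_inner.2 (hx _ h.one_mem)) (hx _ hma)
    (hx _ hmb) (hx _ (h.mul_mem _ hma _ hmb))

theorem exists_add_orthogonal (S : Submodule ℝ (CD 3)) (x : CD 3) :
    ∃ y ∈ S, ∃ z ∈ Sᗮ, y + z = x :=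
  Submodule.mem_sup.1 (Submodule.sup_orthogonal_of_hasOrthogonalProjection (K := S) ▸
    Submodule.mem_top)

theorem associatorMap_mem_orthogonal (ha : a.IsImaginary) (hb : b.IsImaginary) (x : CD 3) :
    associatorMap a b x ∈ (generated {a, b})ᗮ := by
  obtain ⟨y, hy, z, hz, rfl⟩ := exists_add_orthogonal (generated {a, b}) x
  rw [map_add, associatorMap_of_mem_generated ha hb hy, zero_add,
    associatorMap_of_mem_orthogonal ha hb hz]
  exact Submodule.smul_mem _ _
    (mul_mem_orthogonal (isSubalg_generated _) (cross_mem_generated a b) hz)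

theorem cross_mul_cross_mul (a b x : CD 3) :
    cross a b * (cross a b * x) = -(‖cross a b‖ ^ 2 • x) :=
  (isImaginary_cross a b).mul_mul_self_left x

theorem associatorMap_eq_zero_iff (ha : a.IsImaginary) (hb : b.IsImaginary)
    (hab : cross a b ≠ 0) {x : CD 3} : associatorMap a b x = 0 ↔ x ∈ generated {a, b} := by
  refine ⟨fun h => ?_, associatorMap_of_mem_generated ha hb⟩
  obtain ⟨y, hy, z, hz, rfl⟩ := exists_add_orthogonal (generated {a, b}) x
  rw [map_add, associatorMap_of_mem_generated ha hb hy, zero_add,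
    associatorMap_of_mem_orthogonal ha hb hz, smul_eq_zero_iff_right two_ne_zero] at h
  have h₁ := cross_mul_cross_mul a b z
  rw [h, mul_zero, eq_comm, neg_eq_zero,
    smul_eq_zero_iff_right (pow_ne_zero 2 (norm_ne_zero_iff.2 hab))] at h₁
  rwa [h₁, add_zero]

theorem associatorMap_associatorMap (ha : a.IsImaginary) (hb : b.IsImaginary) {x : CD 3}
    (hx : x ∈ (generated {a, b})ᗮ) :
    associatorMap a b (associatorMap a b x) = -((2 * ‖cross a b‖) ^ 2 • x) := by
  rw [associatorMap_of_mem_orthogonal ha hb (associatorMap_mem_orthogonal ha hb x),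
    associatorMap_of_mem_orthogonal ha hb hx, mul_smul_comm, cross_mul_cross_mul, smul_neg,
    smul_neg, smul_smul, smul_smul]
  congr 2
  ring

theorem Eig_one_eq (ha : a.IsImaginary) (hb : b.IsImaginary) (h : ‖a‖ ^ 2 + ‖b‖ ^ 2 = 1)
    (hab : cross a b ≠ 0) :
    (Eig 1 (pair a b) : Set (CD 4)) =
      {z | ∃ x ∈ generated {a, b}, ∃ y ∈ generated {a, b}, z = pair x y} := by
  ext z
  have h₁ := mem_Eig_pair ha hb h 0 z
  rw [add_zero, zero_smul ℝ z.fst, zero_smul ℝ z.snd, neg_zero,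
    associatorMap_eq_zero_iff ha hb hab, associatorMap_eq_zero_iff ha hb hab] at h₁
  refine h₁.trans ⟨fun h => ⟨_, h.2, _, h.1, rfl⟩, ?_⟩
  rintro ⟨x, hx, y, hy, rfl⟩
  exact ⟨hy, hx⟩

/-- As `s ≠ 0`, `D y = s x` puts `x` in the range of `D`, hence in `Sᗮ`, and `D x = -s y` determines
`y`. Conversely `D² = -s²` on `Sᗮ`. -/
theorem mem_Eig_add_iff (ha : a.IsImaginary) (hb : b.IsImaginary) (h : ‖a‖ ^ 2 + ‖b‖ ^ 2 = 1)
    {s : ℝ} (hs : s ≠ 0) (hs₂ : s ^ 2 = (2 * ‖cross a b‖) ^ 2) (z : CD 4) :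
    z ∈ Eig (1 + s) (pair a b) ↔
      ∃ x ∈ (generated {a, b})ᗮ, z = pair x (-(s⁻¹ • associatorMap a b x)) := by
  rw [mem_Eig_pair ha hb h]
  constructor
  · rintro ⟨h₁, h₂⟩
    refine ⟨z.fst, ?_, ext rfl ?_⟩
    · rw [← inv_smul_smul₀ hs z.fst, ← h₁]
      exact Submodule.smul_mem _ _ (associatorMap_mem_orthogonal ha hb _)
    · rw [snd_pair, h₂, smul_neg, neg_neg, inv_smul_smul₀ hs]
  · rintro ⟨x, hx, rfl⟩
    rw [fst_pair, snd_pair, map_neg, map_smul, associatorMap_associatorMap ha hb hx, ← hs₂,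
      smul_neg, smul_neg, neg_neg, neg_neg, smul_inv_smul₀ hs, pow_two, mul_smul,
      inv_smul_smul₀ hs]
    exact ⟨rfl, rfl⟩

theorem eq_of_mem_Eig (ha : a.IsImaginary) (hb : b.IsImaginary) (h : ‖a‖ ^ 2 + ‖b‖ ^ 2 = 1)
    {s : ℝ} (hs : s ≠ 0) {z : CD 4} (hz : z ∈ Eig (1 + s) (pair a b)) (hz₀ : z ≠ 0) :
    s ^ 2 = (2 * ‖cross a b‖) ^ 2 := by
  obtain ⟨h₁, h₂⟩ := (mem_Eig_pair ha hb h s z).1 hz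
  have hx : z.fst ∈ (generated {a, b})ᗮ := by
    rw [← inv_smul_smul₀ hs z.fst, ← h₁]
    exact Submodule.smul_mem _ _ (associatorMap_mem_orthogonal ha hb _)
  have h₃ := associatorMap_associatorMap ha hb hx
  rw [h₂, map_neg, map_smul, h₁, smul_smul, ← pow_two, neg_inj] at h₃
  -- The scalars can be compared because a zero first component would force `z = 0`.
  refine smul_left_injective ℝ (fun h₀ => hz₀ (ext h₀ ?_)) h₃
  rw [h₀, map_zero, eq_comm, neg_eq_zero, smul_eq_zero_iff_right hs] at h₂
  exact h₂

/-- The sign `ε = ±1` treats both nontrivial eigenspaces at once. -/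
theorem Eig_add_eq (ha : a.IsImaginary) (hb : b.IsImaginary) (h : ‖a‖ ^ 2 + ‖b‖ ^ 2 = 1)
    (hab : cross a b ≠ 0) {ε : ℝ} (hε : ε ^ 2 = 1) :
    (Eig (1 + ε * (2 * ‖cross a b‖)) (pair a b) : Set (CD 4)) =
      {z | ∃ x ∈ (generated {a, b})ᗮ,
        z = pair x (-(ε • ((1 / ‖cross a b‖) • cross a b * x)))} := by
  have hn : ‖cross a b‖ ≠ 0 := norm_ne_zero_iff.2 hab
  have hε₀ : ε ≠ 0 := by
    rintro rfl
    norm_num at hε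
  ext z
  refine (mem_Eig_add_iff ha hb h (mul_ne_zero hε₀ (mul_ne_zero two_ne_zero hn))
    (by rw [mul_pow, hε, one_mul]) z).trans (exists_congr fun x => and_congr_right fun hx => ?_)
  have h₁ : (ε * (2 * ‖cross a b‖))⁻¹ * 2 = ε * (1 / ‖cross a b‖) := by
    field_simp
    exact hε.symm
  rw [associatorMap_of_mem_orthogonal ha hb hx, smul_smul, h₁, smul_mul_assoc, smul_smul]

theorem mem_sup_Eig (ha : a.IsImaginary) (hb : b.IsImaginary) (h : ‖a‖ ^ 2 + ‖b‖ ^ 2 = 1)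
    (hab : cross a b ≠ 0) (z : CD 4) :
    z ∈ Eig 1 (pair a b) ⊔ Eig (1 + 2 * ‖cross a b‖) (pair a b) ⊔
      Eig (1 - 2 * ‖cross a b‖) (pair a b) := by
  have hn : ‖cross a b‖ ≠ 0 := norm_ne_zero_iff.2 hab
  have hs : 2 * ‖cross a b‖ ≠ 0 := mul_ne_zero two_ne_zero hn
  set s := 2 * ‖cross a b‖ with hs_def
  obtain ⟨y₁, hy₁, x₁, hx₁, h₁⟩ := exists_add_orthogonal (generated {a, b}) z.fst
  obtain ⟨y₂, hy₂, x₂, hx₂, h₂⟩ := exists_add_orthogonal (generated {a, b}) z.snd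
  set D := associatorMap a b with hD
  -- These `p`, `q` solve `(p, -s⁻¹ D p) + (q, s⁻¹ D q) = (x₁, x₂)`: `p + q = x₁`, and `p - q = s⁻¹
  -- D x₂` with `D² x₂ = -s² x₂`.
  have hp : (1 / 2 : ℝ) • (x₁ + s⁻¹ • D x₂) ∈ (generated {a, b})ᗮ :=
    Submodule.smul_mem _ _ (Submodule.add_mem _ hx₁
      (Submodule.smul_mem _ _ (associatorMap_mem_orthogonal ha hb _)))
  have hq : (1 / 2 : ℝ) • (x₁ - s⁻¹ • D x₂) ∈ (generated {a, b})ᗮ :=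
    Submodule.smul_mem _ _ (Submodule.sub_mem _ hx₁
      (Submodule.smul_mem _ _ (associatorMap_mem_orthogonal ha hb _)))
  refine Submodule.mem_sup.2 ⟨_, Submodule.mem_sup.2 ⟨pair y₁ y₂, ?_, _,
    (mem_Eig_add_iff ha hb h hs rfl _).2 ⟨_, hp, rfl⟩, rfl⟩,
    pair ((1 / 2 : ℝ) • (x₁ - s⁻¹ • D x₂)) (s⁻¹ • D ((1 / 2 : ℝ) • (x₁ - s⁻¹ • D x₂))), ?_, ?_⟩
  · exact (Set.ext_iff.1 (Eig_one_eq ha hb h hab) _).2 ⟨_, hy₁, _, hy₂, rfl⟩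
  · rw [sub_eq_add_neg, mem_Eig_add_iff ha hb h (neg_ne_zero.2 hs) (neg_sq s)]
    refine ⟨_, hq, ?_⟩
    rw [inv_neg, neg_smul, neg_neg]
  · have h₃ : D (D x₂) = -(s ^ 2 • x₂) := associatorMap_associatorMap ha hb hx₂
    apply ext
    · rw [fst_add, fst_add, fst_pair, fst_pair, fst_pair, ← h₁]
      module
    · rw [snd_add, snd_add, snd_pair, snd_pair, snd_pair, ← h₂, map_smul, map_smul, map_add,
        map_sub, map_smul, h₃]
      match_scalars <;> field_simp <;> norm_num

theorem isInternal_Eig (ha : a.IsImaginary) (hb : b.IsImaginary) (h : ‖a‖ ^ 2 + ‖b‖ ^ 2 = 1)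
    (hab : cross a b ≠ 0) :
    DirectSum.IsInternal ![Eig 1 (pair a b), Eig (1 + 2 * ‖cross a b‖) (pair a b),
      Eig (1 - 2 * ‖cross a b‖) (pair a b)] := by
  have hn : 0 < ‖cross a b‖ := norm_pos_iff.2 hab
  rw [DirectSum.isInternal_submodule_iff_iSupIndep_and_iSup_eq_top]
  constructor
  · have hinj : Function.Injective ![1, 1 + 2 * ‖cross a b‖, 1 - 2 * ‖cross a b‖] := by
      intro i j hij
      fin_cases i <;> fin_cases j <;> simp at hij ⊢ <;> first | contradiction | linarith
    convert (Module.End.eigenspaces_iSupIndep (M (pair a b))).comp hinj using 1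
    ext i : 1
    fin_cases i <;> rfl
  · rw [eq_top_iff]
    have hle : ∀ i : Fin 3, _ ≤ ⨆ j, _ := le_iSup ![Eig 1 (pair a b),
      Eig (1 + 2 * ‖cross a b‖) (pair a b), Eig (1 - 2 * ‖cross a b‖) (pair a b)]
    exact fun z _ => sup_le (sup_le (hle 0) (hle 1)) (hle 2) (mem_sup_Eig ha hb h hab z)

theorem hasEigenvalue_iff (ha : a.IsImaginary) (hb : b.IsImaginary) (h : ‖a‖ ^ 2 + ‖b‖ ^ 2 = 1)
    (hab : cross a b ≠ 0) (r : ℝ) :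
    Module.End.HasEigenvalue (M (pair a b)) r ↔
      r = 1 ∨ r = 1 + 2 * ‖cross a b‖ ∨ r = 1 - 2 * ‖cross a b‖ := by
  have hs : 2 * ‖cross a b‖ ≠ 0 := mul_ne_zero two_ne_zero (norm_ne_zero_iff.2 hab)
  have key : ∀ s : ℝ, s ≠ 0 → s ^ 2 = (2 * ‖cross a b‖) ^ 2 →
      Module.End.HasEigenvalue (M (pair a b)) (1 + s) := by
    intro s hs₀ hs₁
    obtain ⟨x, hx, hx₀⟩ := exists_ne_zero_mem_orthogonal_generated ha hb
    exact (Submodule.ne_bot_iff _).2 ⟨_, (mem_Eig_add_iff ha hb h hs₀ hs₁ _).2 ⟨x, hx, rfl⟩,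
      fun h₀ => hx₀ (congrArg fst h₀)⟩
  constructor
  · intro hr
    obtain ⟨z, hz, hz₀⟩ := hr.exists_hasEigenvector
    by_cases hr₁ : r = 1
    · exact Or.inl hr₁
    · have hz' : z ∈ Eig (1 + (r - 1)) (pair a b) := by rwa [add_sub_cancel]
      rcases sq_eq_sq_iff_eq_or_eq_neg.1
        (eq_of_mem_Eig ha hb h (sub_ne_zero.2 hr₁) hz' hz₀) with h₁ | h₁
      · exact Or.inr (Or.inl (by linarith))
      · exact Or.inr (Or.inr (by linarith))
  · rintro (rfl | rfl | rfl)
    · refine (Submodule.ne_bot_iff _).2 ⟨1, (Set.ext_iff.1 (Eig_one_eq ha hb h hab) 1).2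
        ⟨1, (isSubalg_generated _).one_mem, 0, Submodule.zero_mem _, rfl⟩, fun h₀ => ?_⟩
      have h₁ := reCoord_one 4
      rw [h₀, ← zero_smul ℝ (1 : CD 4), reCoord_smul, zero_mul] at h₁
      exact zero_ne_one h₁
    · exact key _ hs rfl
    · rw [sub_eq_add_neg]
      exact key _ (neg_ne_zero.2 hs) (neg_sq _)

end Generated

/-! ### Elements orthogonal to `ℂ_4`. -/

/-- Pairing with `1` and with `(0, 1)` reads off the real parts of the two components. -/
theorem isImaginary_fst_snd {n : ℕ} {u : CD (n + 1)} (hu : u ∈ (complexLine n)ᗮ) :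
    u.fst.IsImaginary ∧ u.snd.IsImaginary := by
  have h₁ := hu 1 (Submodule.subset_span (Set.mem_insert _ _))
  have h₂ := hu (iElt n) (Submodule.subset_span (Set.mem_insert_of_mem _ rfl))
  rw [real_inner_comm, inner_def, reCoord_mul_star] at h₁ h₂
  simp only [fst_one, snd_one, iElt, fst_pair, snd_pair, star_one, star_zero, mul_one,
    mul_zero] at h₁ h₂
  have h₀ : reCoord n (0 : CD n) = 0 := by
    rw [← zero_smul ℝ (1 : CD n), reCoord_smul, zero_mul]
  rw [h₀, add_zero] at h₁
  rw [h₀, zero_add] at h₂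
  exact ⟨isImaginary_iff.2 h₁, isImaginary_iff.2 h₂⟩

theorem IsImaginary.smul {n : ℕ} {x : CD n} (hx : x.IsImaginary) (r : ℝ) :
    (r • x).IsImaginary := by
  rw [isImaginary_iff, reCoord_smul, isImaginary_iff.1 hx, mul_zero]

theorem exists_normalized {u : CD 4} (hu : u ≠ 0) (hu' : u ∈ (complexLine 3)ᗮ) :
    ∃ (t : ℝ) (a b : CD 3), 0 < t ∧ a.IsImaginary ∧ b.IsImaginary ∧ ‖a‖ ^ 2 + ‖b‖ ^ 2 = 1 ∧
      u = t • pair a b := by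
  have ht : ‖u‖ ≠ 0 := norm_ne_zero_iff.2 hu
  obtain ⟨ha, hb⟩ := isImaginary_fst_snd hu'
  refine ⟨‖u‖, ‖u‖⁻¹ • u.fst, ‖u‖⁻¹ • u.snd, norm_pos_iff.2 hu, ha.smul _, hb.smul _, ?_, ?_⟩
  · rw [norm_smul, norm_smul, mul_pow, mul_pow, ← mul_add, ← norm_sq_eq, norm_inv, norm_norm,
      ← mul_pow, inv_mul_cancel₀ ht, one_pow]
  · exact (smul_inv_smul₀ ht u).symm

end CD

theorem mainTheorem5 :
    -- the unit elements `(a, b)` with `a`, `b` imaginary and linearly independent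
    (∀ a b : CD 3, a.IsImaginary → b.IsImaginary → LinearIndependent ℝ ![a, b] →
      ‖a‖ ^ 2 + ‖b‖ ^ 2 = 1 →
      ∀ c : CD 3, c = (1 / ‖CD.cross a b‖) • CD.cross a b →
        -- `(a, b)` is a unit vector, and `c` is well defined
        ‖CD.pair a b‖ = 1 ∧ CD.cross a b ≠ 0 ∧
        -- the three eigenspaces
        (CD.Eig 1 (CD.pair a b) : Set (CD 4)) =
          {z | ∃ x ∈ CD.generated {a, b}, ∃ y ∈ CD.generated {a, b}, z = CD.pair x y} ∧
        (CD.Eig (1 + 2 * ‖CD.cross a b‖) (CD.pair a b) : Set (CD 4)) =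
          {z | ∃ x ∈ (CD.generated {a, b})ᗮ, z = CD.pair x (-(c * x))} ∧
        (CD.Eig (1 - 2 * ‖CD.cross a b‖) (CD.pair a b) : Set (CD 4)) =
          {z | ∃ x ∈ (CD.generated {a, b})ᗮ, z = CD.pair x (c * x)} ∧
        -- their direct sum is the whole algebra, and there are no other eigenvalues
        DirectSum.IsInternal ![CD.Eig 1 (CD.pair a b),
          CD.Eig (1 + 2 * ‖CD.cross a b‖) (CD.pair a b),
          CD.Eig (1 - 2 * ‖CD.cross a b‖) (CD.pair a b)] ∧
        (∀ r : ℝ, Module.End.HasEigenvalue (CD.M (CD.pair a b)) r ↔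
          r = 1 ∨ r = 1 + 2 * ‖CD.cross a b‖ ∨ r = 1 - 2 * ‖CD.cross a b‖)) ∧
    -- every non-zero element orthogonal to `ℂ_4` is, up to a positive real scalar, which does not
    -- change the eigentheory, such an `(a, b)` or has linearly dependent components, and in the
    -- latter case its operator is the identity
    (∀ u : CD 4, u ≠ 0 → u ∈ (CD.complexLine 3)ᗮ →
      ∃ (t : ℝ) (a b : CD 3), 0 < t ∧ a.IsImaginary ∧ b.IsImaginary ∧ ‖a‖ ^ 2 + ‖b‖ ^ 2 = 1 ∧
        u = t • CD.pair a b ∧ CD.M u = CD.M (CD.pair a b) ∧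
        (¬ LinearIndependent ℝ ![a, b] → CD.M u = LinearMap.id)) := by
  refine ⟨fun a b ha hb hli h c hc => ?_, fun u hu hu' => ?_⟩
  · subst hc
    have hab := CD.cross_ne_zero ha hb hli
    refine ⟨CD.norm_pair h, hab, CD.Eig_one_eq ha hb h hab, ?_, ?_, CD.isInternal_Eig ha hb h hab,
      CD.hasEigenvalue_iff ha hb h hab⟩
    · have h₁ := CD.Eig_add_eq ha hb h hab (one_pow 2)
      simp only [one_mul, one_smul ℝ] at h₁
      exact h₁
    · have h₁ := CD.Eig_add_eq ha hb h hab (neg_one_sq (R := ℝ))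
      simp only [neg_mul, one_mul, neg_smul, one_smul ℝ, neg_neg, ← sub_eq_add_neg] at h₁
      exact h₁
  · obtain ⟨t, a, b, ht, ha, hb, h, rfl⟩ := CD.exists_normalized hu hu'
    have hM := CD.M_smul ht.ne' (CD.pair a b)
    exact ⟨t, a, b, ht, ha, hb, h, rfl, hM, fun hab => hM.trans (CD.M_pair_eq_id ha hb h hab)⟩
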